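/- **Lemma 2.1 (Quadratic form).** Let $V:\mathbb R^3\to\mathbb R$ be in the Kato class, i.e. $V$ is measurable and $$\lim_{r\to0+}\ \sup_{x\in\mathbb R^3}\int_{|x-y|\le r}\frac{|V(y)|}{|x-y|}\,dy=0 .$$ Let $\mathcal H=-\Delta+V$, and let $q$ be its quadratic form $$q(u,v)=\int_{\mathbb R^3}u\,\overline{\mathcal Hv}\,dx ,$$ understood for $u,v\in H^1(\mathbb R^3)$ (complex-valued) as $$q(u,v)=\int_{\mathbb R^3}\nabla u\cdot\overline{\nabla v}\,dx+\int_{\mathbb R^3}V\,u\,\overline v\,dx .$$ Then: 1. The integrals defining $q(u,v)$ converge absolutely for all $u,v\in H^1$. If $u\in H^1$ and $v$ is a Schwartz function, then $u\,\overline{(-\Delta v+Vv)}$ is integrable and $q(u,v)=\int_{\mathbb R^3}u\,\overline{(-\Delta v+Vv)}\,dx$. 2. There exists $a_0>1$ such that for every $a\ge a_0$ and every $u\in H^1$ the number $q(u,u)$ is real and $$\tfrac12\|\nabla u\|_{L^2}^2-a\|u\|_{L^2}^2\ \le\ q(u,u)\ \le\ \tfrac32\|\nabla u\|_{L^2}^2+a\|u\|_{L^2}^2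 .$$ 3. Consequently $q$ is a lower semibounded closed form with form domain $H^1$. That is, $H^1$ is dense in $L^2$; $q$ is a Hermitian sesquilinear form on $H^1$; there is $M\in\mathbb R$ with $q(u,u)\ge -M\|u\|_{L^2}^2$ for all $u\in H^1$; and if $u_n\in H^1$, $u_n\to u$ in $L^2$ and $q(u_n-u_m,u_n-u_m)\to0$ as $n,m\to\infty$, then $u\in H^1$ and $q(u_n-u,u_n-u)\to0$. -/

import Mathlib

open MeasureTheory Filter Topology
open scoped ENNReal SchwartzMap LineDeriv Laplacian ComplexConjugate

noncomputable section

namespace KatoForm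

/-- Euclidean space `ℝ³`. -/
abbrev R3 : Type := EuclideanSpace ℝ (Fin 3)

/-- The complex Hilbert space `L²(ℝ³)`. -/
abbrev L2 : Type := Lp ℂ 2 (volume : Measure R3)

/-- The Kato class: real-valued (Lebesgue measurable) functions `V` on `ℝ³` with
`lim_{r → 0+} sup_x ∫_{|x-y| ≤ r} |V(y)| / |x-y| dy = 0`. The integral is the Lebesgue integral of
a nonnegative function with values in `[0, ∞]`. -/
def IsKatoClass (V : R3 → ℝ) : Prop :=
  AEMeasurable V volume ∧
    Tendsto (fun r : ℝ => ⨆ x : R3, ∫⁻ y in Metric.closedBall x r, ‖V y‖ₑ / ‖x - y‖ₑ)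
      (𝓝[>] 0) (𝓝 0)

/-- The Sobolev space `H¹(ℝ³)`, as a subspace of `L²(ℝ³)`. -/
def H1 : Submodule ℂ L2 where
  carrier := {u | TemperedDistribution.MemSobolev 1 2 (u : 𝓢'(R3, ℂ))}
  zero_mem' := by
    have h : ((0 : L2) : 𝓢'(R3, ℂ)) = 0 := by
      rw [← Lp.toTemperedDistributionCLM_apply, map_zero]
    simp only [Set.mem_ofPred_eq, h, TemperedDistribution.memSobolev_fun_zero]
  add_mem' := by
    intro u v hu hv
    have h : ((u + v : L2) : 𝓢'(R3, ℂ)) = (u : 𝓢'(R3, ℂ)) + (v : 𝓢'(R3, ℂ)) := by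
      simp only [← Lp.toTemperedDistributionCLM_apply, map_add]
    simp only [Set.mem_ofPred_eq, h] at hu hv ⊢
    exact hu.add hv
  smul_mem' := by
    intro c u hu
    have h : ((c • u : L2) : 𝓢'(R3, ℂ)) = c • (u : 𝓢'(R3, ℂ)) := by
      simp only [← Lp.toTemperedDistributionCLM_apply, map_smul]
    simp only [Set.mem_ofPred_eq, h] at hu ⊢
    exact hu.smul c

/-- The distributional partial derivatives of an `H¹` function are `L²` functions. -/
theorem exists_partial (i : Fin 3) (u : H1) :
    ∃ g : L2, ∂_{(EuclideanSpace.single i (1 : ℝ) : R3)} ((u : L2) : 𝓢'(R3, ℂ))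
      = (g : 𝓢'(R3, ℂ)) := by
  have h := TemperedDistribution.MemSobolev.lineDerivOp
    (m := (EuclideanSpace.single i (1 : ℝ) : R3)) u.2
  rw [sub_self] at h
  exact TemperedDistribution.memSobolev_zero_iff.mp h

/-- The `i`-th distributional partial derivative `∂ᵢu ∈ L²(ℝ³)` of `u ∈ H¹(ℝ³)`. -/
def partialDeriv (i : Fin 3) (u : H1) : L2 := (exists_partial i u).choose

theorem partialDeriv_spec (i : Fin 3) (u : H1) :
    ∂_{(EuclideanSpace.single i (1 : ℝ) : R3)} ((u : L2) : 𝓢'(R3, ℂ))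
      = (partialDeriv i u : 𝓢'(R3, ℂ)) := (exists_partial i u).choose_spec

/-- `‖∇u‖²`, the square of the `L²` norm of the gradient. -/
def gradNormSq (u : H1) : ℝ := ∑ i : Fin 3, ‖partialDeriv i u‖ ^ 2

/-- The form `q(u, v) = ∫ ∇u · conj(∇v) + ∫ V u conj(v)` of `-Δ + V` on `H¹(ℝ³)`. -/
def q (V : R3 → ℝ) (u v : H1) : ℂ :=
  (∑ i : Fin 3, ∫ x, partialDeriv i u x * conj (partialDeriv i v x))
    + ∫ x, (V x : ℂ) * ((u : L2) x * conj ((v : L2) x))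

theorem mem_H1_iff (u : L2) : u ∈ H1 ↔ TemperedDistribution.MemSobolev 1 2 (u : 𝓢'(R3, ℂ)) :=
  Iff.rfl

theorem toLp_mem_H1 (f : 𝓢(R3, ℂ)) : (f.toLp 2 volume : L2) ∈ H1 := by
  rw [mem_H1_iff, Lp.toTemperedDistribution_toLp_eq]
  exact f.memSobolev

/-- A Schwartz function as an element of `H¹(ℝ³)`. -/
def schwartzToH1 (f : 𝓢(R3, ℂ)) : H1 := ⟨f.toLp 2 volume, toLp_mem_H1 f⟩

/-- The Schrödinger operator `(-Δ + V) f`, as a function, for a Schwartz function `f`. -/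
def schrodinger (V : R3 → ℝ) (f : 𝓢(R3, ℂ)) (x : R3) : ℂ := -(Δ f) x + (V x : ℂ) * f x

/-- `Q` is a lower semibounded Hermitian sesquilinear form (linear in the first variable) with the
dense subspace `D` of the Hilbert space `H` as its domain. -/
structure IsLowerSemiboundedForm {H : Type*} [NormedAddCommGroup H] [InnerProductSpace ℂ H]
    (D : Submodule ℂ H) (Q : D → D → ℂ) : Prop where
  dense : Dense (D : Set H)
  add_left : ∀ u v w : D, Q (u + v) w = Q u w + Q v w
  smul_left : ∀ (c : ℂ) (u v : D), Q (c • u) v = c * Q u v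
  conj_symm : ∀ u v : D, conj (Q u v) = Q v u
  lower_bound : ∃ M : ℝ, ∀ u : D, -M * ‖(u : H)‖ ^ 2 ≤ (Q u u).re

/-- The form `Q` with domain `D` is closed: if `uₙ ∈ D` converges to `u` in `H` and
`Q(uₙ - uₘ, uₙ - uₘ) → 0` as `n, m → ∞`, then `u ∈ D` and `Q(uₙ - u, uₙ - u) → 0`. -/
def IsClosedForm {H : Type*} [NormedAddCommGroup H] [InnerProductSpace ℂ H]
    (D : Submodule ℂ H) (Q : D → D → ℂ) : Prop :=
  ∀ (s : ℕ → D) (u : H), Tendsto (fun n => (s n : H)) atTop (𝓝 u) →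
    Tendsto (fun p : ℕ × ℕ => Q (s p.1 - s p.2) (s p.1 - s p.2)) atTop (𝓝 0) →
    ∃ hu : u ∈ D, Tendsto (fun n => Q (s n - ⟨u, hu⟩) (s n - ⟨u, hu⟩)) atTop (𝓝 0)

end KatoForm

end

/-!
Let `d` be the dimension and `S` the unit sphere. Averaging the fundamental theorem of calculus for
`s ↦ (1 - s / r) u (x + s ω)` on `[0, r]` over the directions `ω` bounds `|S| |u(x)|` by the
integral of `|x - y|^{1-d} (|∇u(y)| + |u(y)| / r)` over `|x - y| ≤ r`. The composition of this
truncated kernel with its transpose is dominated by the truncated kernel `|x - x'|^{2-d}`, which for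
`d = 3` is that of the Kato condition, so the Schur test in `L²(|V| dx)` gives
`∫ |V| |u|² ≤ ε ‖∇u‖² + C ‖u‖²` for smooth `u`, with `ε` as small as we please. The bound passes to
`H¹` by density of the Schwartz functions and Fatou's lemma. With `ε = 1/2` it makes `q` lower
semibounded, and it makes `q(u, u) + a ‖u‖²` equivalent to the square of the `H¹` norm for large
`a`; hence `q` is closed.
-/

noncomputable section

namespace KatoForm

section RieszKernel

variable {E : Type*} [NormedAddCommGroup E]

/-- The truncated Riesz kernel `|z|⁻ⁿ 1_{|z| ≤ r}`, with values in `[0, ∞]`; for `n ≠ 0` its value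
at `0` is `∞` when `0 ≤ r`. It is the kernel of the pointwise bound of a function by its gradient
(`n = dim E - 1`) and of the Kato condition (`n = dim E - 2`). -/
def rieszKernel (n : ℕ) (r : ℝ) : E → ℝ≥0∞ :=
  (Metric.closedBall 0 r).indicator fun z => (‖z‖ₑ ^ n)⁻¹

theorem rieszKernel_of_norm_le {n : ℕ} {r : ℝ} {z : E} (hz : ‖z‖ ≤ r) :
    rieszKernel n r z = (‖z‖ₑ ^ n)⁻¹ :=
  Set.indicator_of_mem (mem_closedBall_zero_iff.mpr hz) _

theorem rieszKernel_of_lt_norm {n : ℕ} {r : ℝ} {z : E} (hz : r < ‖z‖) : rieszKernel n r z = 0 :=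
  Set.indicator_of_notMem (fun h => hz.not_ge (mem_closedBall_zero_iff.mp h)) _

theorem rieszKernel_neg (n : ℕ) (r : ℝ) (z : E) : rieszKernel n r (-z) = rieszKernel n r z := by
  simp only [rieszKernel, Set.indicator, mem_closedBall_zero_iff, norm_neg, enorm_neg]

@[fun_prop]
theorem measurable_rieszKernel [MeasurableSpace E] [BorelSpace E] (n : ℕ) (r : ℝ) :
    Measurable (rieszKernel n r : E → ℝ≥0∞) :=
  (measurable_enorm.pow_const n).inv.indicator Metric.isClosed_closedBall.measurableSet

theorem rieszKernel_mul_rieszKernel_eq_zero (n : ℕ) {r : ℝ} {w z : E} (h : 2 * r < ‖w - z‖) :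
    rieszKernel n r w * rieszKernel n r z = 0 := by
  rcases le_or_gt ‖w‖ r with hw | hw
  · rw [rieszKernel_of_lt_norm (z := z) (by linarith [norm_sub_le w z]), mul_zero]
  · rw [rieszKernel_of_lt_norm hw, zero_mul]

theorem rieszKernel_mul_rieszKernel_le (n : ℕ) (r c : ℝ) {w z : E} (hc : 2 * c ≤ ‖w - z‖) :
    rieszKernel n r w * rieszKernel n r z ≤
      (‖w‖ₑ ^ n)⁻¹ * (ENNReal.ofReal (max ‖w‖ c) ^ n)⁻¹ +
        (‖z‖ₑ ^ n)⁻¹ * (ENNReal.ofReal (max ‖z‖ c) ^ n)⁻¹ := by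
  have hle {w z : E} (hc : 2 * c ≤ ‖w - z‖) (hwz : ‖w‖ ≤ ‖z‖) :
      rieszKernel n r w * rieszKernel n r z ≤
        (‖w‖ₑ ^ n)⁻¹ * (ENNReal.ofReal (max ‖w‖ c) ^ n)⁻¹ := by
    refine mul_le_mul' (Set.indicator_le_self _ _ w) ((Set.indicator_le_self _ _ z).trans ?_)
    rw [← ofReal_norm z]
    gcongr
    exact max_le hwz (by linarith [norm_sub_le w z])
  rcases le_total ‖w‖ ‖z‖ with hwz | hzw
  · exact (hle hc hwz).trans le_self_add
  · rw [mul_comm]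
    exact (hle (norm_sub_rev w z ▸ hc) hzw).trans le_add_self

end RieszKernel

section HalfLine

theorem enorm_le_lintegral_ray {F : Type*} [NormedAddCommGroup F] [NormedSpace ℝ F]
    {f : ℝ → F} (hf : ContDiff ℝ 1 f) {r : ℝ} (hr : 0 < r) :
    ‖f 0‖ₑ ≤ ∫⁻ s in Set.Icc 0 r, (‖deriv f s‖ₑ + ‖f s‖ₑ / ENNReal.ofReal r) := by
  have hd (s : ℝ) : HasDerivAt (fun s => (1 - s / r) • f s)
      ((1 - s / r) • deriv f s + (-(1 / r)) • f s) s :=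
    (((hasDerivAt_id s).div_const r).const_sub 1).smul
      (hf.differentiable (by norm_num) s).hasDerivAt
  have h := enorm_sub_le_lintegral_deriv_of_contDiffOn_Icc
    (f := fun s => (1 - s / r) • f s) (a := 0) (b := r) (by fun_prop) hr.le
  simp only [div_self hr.ne', sub_self, zero_smul, zero_div, sub_zero, one_smul, zero_sub,
    enorm_neg] at h
  refine h.trans (setLIntegral_mono' measurableSet_Icc fun s hs => ?_)
  have hs' : |1 - s / r| ≤ 1 := by
    have := div_le_one_of_le₀ hs.2 hr.le
    have := div_nonneg hs.1 hr.le
    rw [abs_le]; constructor <;> linarith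
  rw [(hd s).deriv]
  refine (enorm_add_le _ _).trans (add_le_add ?_ ?_)
  · rw [enorm_smul]
    refine mul_le_of_le_one_left' ?_
    rwa [Real.enorm_eq_ofReal_abs, ENNReal.ofReal_le_one]
  · rw [enorm_smul, enorm_neg, Real.enorm_of_nonneg (by positivity), one_div,
      ENNReal.ofReal_inv_of_pos hr, mul_comm, div_eq_mul_inv]

theorem lintegral_Ioi_inv_pow_le {n : ℕ} (hn : 2 ≤ n) {c : ℝ} (hc : 0 < c) :
    ∫⁻ s in Set.Ioi c, (ENNReal.ofReal s ^ n)⁻¹ ≤ (ENNReal.ofReal c ^ (n - 1))⁻¹ := by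
  have hn' : (1 : ℝ) ≤ (n : ℝ) - 1 := by
    have : (2 : ℝ) ≤ n := by exact_mod_cast hn
    linarith
  have hlt : -(n : ℝ) < -1 := by linarith
  calc ∫⁻ s in Set.Ioi c, (ENNReal.ofReal s ^ n)⁻¹
      = ∫⁻ s in Set.Ioi c, ENNReal.ofReal (s ^ (-(n : ℝ))) := by
        refine setLIntegral_congr_fun measurableSet_Ioi fun s (hs : c < s) => ?_
        have hs0 := hc.trans hs
        rw [Real.rpow_neg hs0.le, Real.rpow_natCast, ENNReal.ofReal_inv_of_pos (pow_pos hs0 n),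
          ENNReal.ofReal_pow hs0.le]
    _ = ENNReal.ofReal (c ^ (1 - (n : ℝ)) / (n - 1)) := by
        have hnonneg : 0 ≤ᵐ[volume.restrict (Set.Ioi c)] fun s => s ^ (-(n : ℝ)) :=
          (ae_restrict_mem measurableSet_Ioi).mono fun s (hs : c < s) =>
            Real.rpow_nonneg (hc.trans hs).le _
        rw [← ofReal_integral_eq_lintegral_ofReal (integrableOn_Ioi_rpow_of_lt hlt hc) hnonneg,
          integral_Ioi_rpow_of_lt hlt hc, ← neg_div_neg_eq, neg_neg, neg_add_rev, neg_neg]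
        ring_nf
    _ ≤ ENNReal.ofReal ((c ^ (n - 1))⁻¹) := by
        rw [← neg_sub, Real.rpow_neg hc.le, ← Real.rpow_natCast c (n - 1), Nat.cast_pred (by lia)]
        exact ENNReal.ofReal_le_ofReal (div_le_self (by positivity) hn')
    _ = (ENNReal.ofReal c ^ (n - 1))⁻¹ := by
        rw [ENNReal.ofReal_inv_of_pos (pow_pos hc _), ENNReal.ofReal_pow hc.le]

theorem lintegral_Ioi_inv_max_pow_le {n : ℕ} (hn : 2 ≤ n) (c : ℝ) :
    ∫⁻ s in Set.Ioi (0 : ℝ), (ENNReal.ofReal (max s c) ^ n)⁻¹ ≤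
      2 * (ENNReal.ofReal c ^ (n - 1))⁻¹ := by
  rcases le_or_gt c 0 with hc | hc
  · simp [ENNReal.ofReal_of_nonpos hc, (by lia : n - 1 ≠ 0)]
  have hc0 : ENNReal.ofReal c ≠ 0 := (ENNReal.ofReal_pos.mpr hc).ne'
  rw [← Set.Ioc_union_Ioi_eq_Ioi hc.le, lintegral_union measurableSet_Ioi
    (Set.Ioc_disjoint_Ioi le_rfl), two_mul]
  refine add_le_add (le_of_eq ?_) ?_
  · calc ∫⁻ s in Set.Ioc 0 c, (ENNReal.ofReal (max s c) ^ n)⁻¹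
        = ∫⁻ _ in Set.Ioc 0 c, (ENNReal.ofReal c ^ n)⁻¹ :=
          setLIntegral_congr_fun measurableSet_Ioc fun s hs => by simp only [max_eq_right hs.2]
      _ = (ENNReal.ofReal c ^ (n - 1))⁻¹ := by
          rw [setLIntegral_const, Real.volume_Ioc, sub_zero, ← Nat.sub_add_cancel (by lia : 1 ≤ n),
            pow_succ, Nat.add_sub_cancel, ENNReal.mul_inv (.inr ENNReal.ofReal_ne_top) (.inr hc0),
            mul_assoc, ENNReal.inv_mul_cancel hc0 ENNReal.ofReal_ne_top, mul_one]
  · refine le_trans (le_of_eq ?_) (lintegral_Ioi_inv_pow_le hn hc)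
    exact setLIntegral_congr_fun measurableSet_Ioi fun s (hs : c < s) => by
      simp only [max_eq_left hs.le]

end HalfLine

section Polar

variable {E F : Type*} [NormedAddCommGroup E] [NormedSpace ℝ E]
  [NormedAddCommGroup F] [NormedSpace ℝ F]

theorem enorm_le_lintegral_segment {u : E → F} (hu : ContDiff ℝ 1 u) {r : ℝ} (hr : 0 < r) (x : E)
    {ω : E} (hω : ‖ω‖ = 1) : ‖u x‖ₑ ≤ ∫⁻ s in Set.Icc 0 r,
      (‖fderiv ℝ u (x + s • ω)‖ₑ + ‖u (x + s • ω)‖ₑ / ENNReal.ofReal r) := by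
  have h := enorm_le_lintegral_ray (f := fun s : ℝ => u (x + s • ω)) (by fun_prop) hr
  simp only [zero_smul, add_zero] at h
  refine h.trans (lintegral_mono fun s => add_le_add_left ?_ _)
  have hd : HasDerivAt (fun s : ℝ => u (x + s • ω)) (fderiv ℝ u (x + s • ω) ω) s :=
    ((hu.differentiable one_ne_zero _).hasFDerivAt).comp_hasDerivAt s
      (by simpa using ((hasDerivAt_id s).smul_const ω).const_add x)
  rw [hd.deriv]
  refine (ContinuousLinearMap.le_opENorm _ _).trans_eq ?_
  rw [← ofReal_norm ω, hω, ENNReal.ofReal_one, mul_one]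

theorem lintegral_rieszKernel_segment (n : ℕ) (r : ℝ) (g : E → ℝ≥0∞) {ω : E} (hω : ‖ω‖ = 1) :
    ∫⁻ s in Set.Ioi (0 : ℝ), ENNReal.ofReal (s ^ n) * (rieszKernel n r (s • ω) * g (s • ω)) =
      ∫⁻ s in Set.Icc 0 r, g (s • ω) := by
  rw [← restrict_Ioc_eq_restrict_Icc, ← Set.Ioi_inter_Iic, Set.inter_comm,
    ← Measure.restrict_restrict measurableSet_Iic, ← lintegral_indicator measurableSet_Iic]
  refine setLIntegral_congr_fun measurableSet_Ioi fun s (hs : 0 < s) => ?_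
  have hn : ‖s • ω‖ = s := by rw [norm_smul, hω, mul_one, Real.norm_of_nonneg hs.le]
  rcases le_or_gt s r with hsr | hsr
  · rw [Set.indicator_of_mem (by exact hsr), rieszKernel_of_norm_le (hn.trans_le hsr), ← mul_assoc,
      ← ofReal_norm, hn, ← ENNReal.ofReal_pow hs.le,
      ENNReal.mul_inv_cancel (ENNReal.ofReal_pos.mpr (pow_pos hs n)).ne' ENNReal.ofReal_ne_top,
      one_mul]
  · rw [Set.indicator_of_notMem (by simpa using hsr), rieszKernel_of_lt_norm (hn.symm ▸ hsr),
      zero_mul, mul_zero]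

variable [FiniteDimensional ℝ E] [Nontrivial E] [MeasurableSpace E] [BorelSpace E]
  (μ : Measure E) [μ.IsAddHaarMeasure]

theorem lintegral_eq_lintegral_toSphere {g : E → ℝ≥0∞} (hg : Measurable g) :
    ∫⁻ z, g z ∂μ = ∫⁻ ω, (∫⁻ s in Set.Ioi (0 : ℝ),
      ENNReal.ofReal (s ^ (Module.finrank ℝ E - 1)) * g (s • (ω : E))) ∂μ.toSphere := by
  calc ∫⁻ z, g z ∂μ = ∫⁻ z : ({0}ᶜ : Set E), g z ∂μ.comap (↑) := by
        rw [lintegral_subtype_comap (measurableSet_singleton _).compl, restrict_compl_singleton]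
    _ = ∫⁻ p : Metric.sphere (0 : E) 1 × Set.Ioi (0 : ℝ), g ((p.2 : ℝ) • (p.1 : E))
          ∂μ.toSphere.prod (.volumeIoiPow (Module.finrank ℝ E - 1)) := by
        rw [← μ.measurePreserving_homeomorphUnitSphereProd.lintegral_comp (by fun_prop)]
        refine lintegral_congr fun z => ?_
        rw [homeomorphUnitSphereProd_apply_snd_coe, homeomorphUnitSphereProd_apply_fst_coe,
          smul_inv_smul₀ (norm_ne_zero_iff.mpr z.2)]
    _ = ∫⁻ ω, (∫⁻ s, g ((s : ℝ) • (ω : E)) ∂.volumeIoiPow (Module.finrank ℝ E - 1)) ∂μ.toSphere :=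
        lintegral_prod _ (by fun_prop)
    _ = _ := by
        refine lintegral_congr fun ω => ?_
        rw [Measure.volumeIoiPow, lintegral_withDensity_eq_lintegral_mul _ (by fun_prop)
          (by fun_prop), ← lintegral_subtype_comap measurableSet_Ioi]
        rfl

theorem toSphere_mul_enorm_le {u : E → F} (hu : ContDiff ℝ 1 u) {r : ℝ} (hr : 0 < r) (x : E) :
    μ.toSphere Set.univ * ‖u x‖ₑ ≤ ∫⁻ y, rieszKernel (Module.finrank ℝ E - 1) r (x - y) *
      (‖fderiv ℝ u y‖ₑ + ‖u y‖ₑ / ENNReal.ofReal r) ∂μ := by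
  set n := Module.finrank ℝ E - 1
  set g : E → ℝ≥0∞ := fun y => ‖fderiv ℝ u y‖ₑ + ‖u y‖ₑ / ENNReal.ofReal r
  have hg : Measurable g := by
    have := (hu.continuous_fderiv one_ne_zero).enorm.measurable
    have := hu.continuous.enorm.measurable
    fun_prop
  calc μ.toSphere Set.univ * ‖u x‖ₑ = ∫⁻ _, ‖u x‖ₑ ∂μ.toSphere := by
        rw [lintegral_const, mul_comm]
    _ ≤ ∫⁻ ω, (∫⁻ s in Set.Icc 0 r, g (x + s • (ω : E))) ∂μ.toSphere :=
        lintegral_mono fun ω => enorm_le_lintegral_segment hu hr x (norm_eq_of_mem_sphere ω)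
    _ = ∫⁻ z, rieszKernel n r z * g (x + z) ∂μ := by
        rw [lintegral_eq_lintegral_toSphere μ (by fun_prop)]
        refine lintegral_congr fun ω => ?_
        rw [lintegral_rieszKernel_segment n r (fun z => g (x + z)) (norm_eq_of_mem_sphere ω)]
    _ = ∫⁻ y, rieszKernel n r (x - y) * g y ∂μ := by
        rw [← lintegral_add_left_eq_self (fun y => rieszKernel n r (x - y) * g y) x]
        refine lintegral_congr fun z => ?_
        rw [sub_add_cancel_left, rieszKernel_neg]

theorem lintegral_inv_pow_mul_norm {f : ℝ → ℝ≥0∞} (hf : Measurable f) :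
    ∫⁻ z : E, (‖z‖ₑ ^ (Module.finrank ℝ E - 1))⁻¹ * f ‖z‖ ∂μ =
      μ.toSphere Set.univ * ∫⁻ s in Set.Ioi 0, f s := by
  rw [lintegral_eq_lintegral_toSphere μ (by fun_prop), mul_comm, ← lintegral_const]
  refine lintegral_congr fun ω => setLIntegral_congr_fun measurableSet_Ioi fun s (hs : 0 < s) => ?_
  have hn : ‖s • (ω : E)‖ = s := by
    rw [norm_smul, norm_eq_of_mem_sphere, mul_one, Real.norm_of_nonneg hs.le]
  rw [← ofReal_norm, hn, ← ENNReal.ofReal_pow hs.le, ← mul_assoc, ENNReal.mul_inv_cancel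
    (ENNReal.ofReal_pos.mpr (pow_pos hs _)).ne' ENNReal.ofReal_ne_top, one_mul]

end Polar

section Schur

theorem two_mul_mul_le_sq_add_sq (a b : ℝ≥0∞) : 2 * a * b ≤ a ^ 2 + b ^ 2 := by
  wlog h : a ≤ b generalizing a b
  · rw [mul_right_comm, add_comm]
    exact this b a (le_of_not_ge h)
  obtain ⟨c, rfl⟩ := exists_add_of_le h
  calc 2 * a * (a + c) ≤ 2 * a * (a + c) + c ^ 2 := le_self_add
    _ = a ^ 2 + (a + c) ^ 2 := by ring

variable {X Y : Type*} [MeasurableSpace X] [MeasurableSpace Y] {ν : Measure X} {μ : Measure Y}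

theorem sq_lintegral_mul_le {f g : X → ℝ≥0∞} (hf : AEMeasurable f ν) (hg : AEMeasurable g ν) :
    (∫⁻ x, f x * g x ∂ν) ^ 2 ≤ (∫⁻ x, f x ^ 2 ∂ν) * ∫⁻ x, g x ^ 2 ∂ν := by
  have h := ENNReal.lintegral_mul_le_Lp_mul_Lq ν .two_two hf hg
  simp only [Pi.mul_apply, ENNReal.rpow_two] at h
  have hsq (a : ℝ≥0∞) : (a ^ (1 / 2 : ℝ)) ^ 2 = a := by
    rw [← ENNReal.rpow_two, ← ENNReal.rpow_mul, one_div_mul_cancel two_ne_zero, ENNReal.rpow_one]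
  grw [h, mul_pow, hsq, hsq]

theorem lintegral_lintegral_mul_mul_le_of_symm [SFinite ν] {L : X → X → ℝ≥0∞}
    (hL : Measurable (Function.uncurry L)) (hsymm : ∀ x x', L x x' = L x' x) {b : X → ℝ≥0∞}
    (hb : Measurable b) {η : ℝ≥0∞} (hη : ∀ x, ∫⁻ x', L x x' ∂ν ≤ η) :
    ∫⁻ x, ∫⁻ x', b x * b x' * L x x' ∂ν ∂ν ≤ η * ∫⁻ x, b x ^ 2 ∂ν := by
  have hdiag : ∫⁻ x, ∫⁻ x', b x ^ 2 * L x x' ∂ν ∂ν ≤ η * ∫⁻ x, b x ^ 2 ∂ν := by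
    rw [← lintegral_const_mul _ (hb.pow_const 2)]
    refine lintegral_mono fun x => ?_
    rw [lintegral_const_mul _ (by fun_prop), mul_comm]
    gcongr
    exact hη x
  have hdiag' : ∫⁻ x, ∫⁻ x', b x' ^ 2 * L x x' ∂ν ∂ν ≤ η * ∫⁻ x, b x ^ 2 ∂ν := by
    rw [lintegral_lintegral_swap (by fun_prop)]
    simpa only [hsymm] using hdiag
  refine (ENNReal.mul_le_mul_iff_right two_ne_zero ENNReal.ofNat_ne_top).mp ?_
  calc 2 * ∫⁻ x, ∫⁻ x', b x * b x' * L x x' ∂ν ∂ν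
      = ∫⁻ x, ∫⁻ x', 2 * b x * b x' * L x x' ∂ν ∂ν := by
        simp only [← lintegral_const_mul' 2 _ ENNReal.ofNat_ne_top, mul_assoc]
    _ ≤ ∫⁻ x, ∫⁻ x', (b x ^ 2 * L x x' + b x' ^ 2 * L x x') ∂ν ∂ν := by
        gcongr with x x'
        grw [two_mul_mul_le_sq_add_sq, add_mul]
    _ = ∫⁻ x, ∫⁻ x', b x ^ 2 * L x x' ∂ν ∂ν + ∫⁻ x, ∫⁻ x', b x' ^ 2 * L x x' ∂ν ∂ν := by
        rw [← lintegral_add_left (by fun_prop)]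
        exact lintegral_congr fun x => lintegral_add_left (by fun_prop) _
    _ ≤ 2 * (η * ∫⁻ x, b x ^ 2 ∂ν) := by grw [hdiag, hdiag', two_mul]

variable [SFinite μ] {K : X → Y → ℝ≥0∞} {b : X → ℝ≥0∞} {g : Y → ℝ≥0∞}

theorem lintegral_sq_lintegral_mul [SFinite ν] (hK : Measurable (Function.uncurry K))
    (hb : Measurable b) : ∫⁻ y, (∫⁻ x, b x * K x y ∂ν) ^ 2 ∂μ =
      ∫⁻ x, ∫⁻ x', b x * b x' * ∫⁻ y, K x y * K x' y ∂μ ∂ν ∂ν := by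
  have hK' : Measurable fun p : X × Y => K p.1 p.2 := hK
  calc ∫⁻ y, (∫⁻ x, b x * K x y ∂ν) ^ 2 ∂μ
      = ∫⁻ y, ∫⁻ x, ∫⁻ x', b x * K x y * (b x' * K x' y) ∂ν ∂ν ∂μ := by
        refine lintegral_congr fun y => ?_
        rw [sq, ← lintegral_mul_const _ (by fun_prop)]
        exact lintegral_congr fun x => (lintegral_const_mul _ (by fun_prop)).symm
    _ = ∫⁻ x, ∫⁻ x', ∫⁻ y, b x * K x y * (b x' * K x' y) ∂μ ∂ν ∂ν := by
        rw [lintegral_lintegral_swap (by fun_prop)]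
        exact lintegral_congr fun x => lintegral_lintegral_swap (by fun_prop)
    _ = _ := by
        refine lintegral_congr fun x => lintegral_congr fun x' => ?_
        rw [← lintegral_const_mul _ (by fun_prop)]
        exact lintegral_congr fun y => by ring

theorem lintegral_sq_le_of_schur_of_ne_top [SFinite ν] (hK : Measurable (Function.uncurry K))
    {η : ℝ≥0∞} (hη : ∀ x, ∫⁻ x', ∫⁻ y, K x y * K x' y ∂μ ∂ν ≤ η) (hg : Measurable g)
    (hb : Measurable b) (hbg : ∀ x, b x ≤ ∫⁻ y, K x y * g y ∂μ) (hfin : ∫⁻ x, b x ^ 2 ∂ν ≠ ∞) :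
    ∫⁻ x, b x ^ 2 ∂ν ≤ η * ∫⁻ y, g y ^ 2 ∂μ := by
  have hK' : Measurable fun p : X × Y => K p.1 p.2 := hK
  set A := ∫⁻ x, b x ^ 2 ∂ν
  have hpair : A ≤ ∫⁻ y, g y * ∫⁻ x, b x * K x y ∂ν ∂μ := by
    calc A ≤ ∫⁻ x, ∫⁻ y, g y * (b x * K x y) ∂μ ∂ν := by
          refine lintegral_mono fun x => ?_
          calc b x ^ 2 ≤ b x * ∫⁻ y, K x y * g y ∂μ := by rw [sq]; gcongr; exact hbg x
            _ = ∫⁻ y, g y * (b x * K x y) ∂μ := by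
              rw [← lintegral_const_mul _ (by fun_prop)]
              exact lintegral_congr fun y => by ring
      _ = _ := by
          rw [lintegral_lintegral_swap (by fun_prop)]
          exact lintegral_congr fun y => lintegral_const_mul _ (by fun_prop)
  have hschur : ∫⁻ y, (∫⁻ x, b x * K x y ∂ν) ^ 2 ∂μ ≤ η * A := by
    rw [lintegral_sq_lintegral_mul hK hb]
    exact lintegral_lintegral_mul_mul_le_of_symm (by fun_prop) (fun x x' => by simp only [mul_comm])
      hb hη
  rcases eq_or_ne A 0 with hA | hA
  · exact hA ▸ zero_le
  refine (ENNReal.mul_le_mul_iff_left hA hfin).mp ?_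
  calc A * A ≤ (∫⁻ y, g y * ∫⁻ x, b x * K x y ∂ν ∂μ) ^ 2 := by grw [← sq, ← hpair]
    _ ≤ (∫⁻ y, g y ^ 2 ∂μ) * (η * A) := by
        grw [sq_lintegral_mul_le hg.aemeasurable (by fun_prop), hschur]
    _ = η * (∫⁻ y, g y ^ 2 ∂μ) * A := by ring

theorem lintegral_sq_le_of_schur [SigmaFinite ν] (hK : Measurable (Function.uncurry K))
    {η : ℝ≥0∞} (hη : ∀ x, ∫⁻ x', ∫⁻ y, K x y * K x' y ∂μ ∂ν ≤ η) (hg : Measurable g)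
    (hb : Measurable b) (hb_top : ∀ x, b x ≠ ∞) (hbg : ∀ x, b x ≤ ∫⁻ y, K x y * g y ∂μ) :
    ∫⁻ x, b x ^ 2 ∂ν ≤ η * ∫⁻ y, g y ^ 2 ∂μ := by
  -- Exhaust `X` by sets on which `∫ b²` is finite, so that it can be cancelled.
  set ρ := ν.withDensity fun x => b x ^ 2
  have : SigmaFinite ρ := SigmaFinite.withDensity_of_ne_top
    (ae_of_all _ fun x => ENNReal.pow_ne_top (hb_top x))
  have hρ (n : ℕ) : ρ.restrict (spanningSets ρ n) Set.univ =
      ∫⁻ x in spanningSets ρ n, b x ^ 2 ∂ν := by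
    rw [Measure.restrict_apply_univ, withDensity_apply _ (measurableSet_spanningSets ρ n)]
  rw [← setLIntegral_univ, ← withDensity_apply _ .univ, ← Measure.iSup_restrict_spanningSets]
  refine iSup_le fun n => (hρ n).trans_le ?_
  refine lintegral_sq_le_of_schur_of_ne_top hK (fun x => ?_) hg hb hbg ?_
  · exact (setLIntegral_le_lintegral _ _).trans (hη x)
  · rw [← hρ, Measure.restrict_apply_univ]
    exact (measure_spanningSets_lt_top ρ n).ne

end Schur

section SmoothBound

variable {E F : Type*} [NormedAddCommGroup E] [NormedSpace ℝ E] [FiniteDimensional ℝ E]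
  [MeasurableSpace E] [BorelSpace E] [NormedAddCommGroup F] [NormedSpace ℝ F]
  (μ : Measure E) [μ.IsAddHaarMeasure]

theorem lintegral_rieszKernel_mul_rieszKernel_le (hd : 3 ≤ Module.finrank ℝ E) (r : ℝ) (x x' : E) :
    ∫⁻ y, rieszKernel (Module.finrank ℝ E - 1) r (x - y) *
        rieszKernel (Module.finrank ℝ E - 1) r (x' - y) ∂μ ≤
      2 ^ Module.finrank ℝ E * μ.toSphere Set.univ *
        rieszKernel (Module.finrank ℝ E - 2) (2 * r) (x - x') := by
  have : Nontrivial E := Module.nontrivial_of_finrank_pos (R := ℝ) (by lia)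
  set n := Module.finrank ℝ E - 1
  rcases lt_or_ge (2 * r) ‖x - x'‖ with hfar | hnear
  · have hdisj (y : E) : rieszKernel n r (x - y) * rieszKernel n r (x' - y) = 0 :=
      rieszKernel_mul_rieszKernel_eq_zero n (by rwa [sub_sub_sub_cancel_right])
    simp only [hdisj, lintegral_zero, zero_le]
  set f : ℝ → ℝ≥0∞ := fun s => (ENNReal.ofReal (max s (‖x - x'‖ / 2)) ^ n)⁻¹
  have hf : Measurable f := by fun_prop
  have hint (x : E) : ∫⁻ y, (‖x - y‖ₑ ^ n)⁻¹ * f ‖x - y‖ ∂μ =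
      μ.toSphere Set.univ * ∫⁻ s in Set.Ioi 0, f s := by
    rw [lintegral_sub_left_eq_self (fun z => (‖z‖ₑ ^ n)⁻¹ * f ‖z‖) x,
      lintegral_inv_pow_mul_norm μ hf]
  calc ∫⁻ y, rieszKernel n r (x - y) * rieszKernel n r (x' - y) ∂μ
      ≤ ∫⁻ y, ((‖x - y‖ₑ ^ n)⁻¹ * f ‖x - y‖ + (‖x' - y‖ₑ ^ n)⁻¹ * f ‖x' - y‖) ∂μ :=
        lintegral_mono fun y => rieszKernel_mul_rieszKernel_le n r _ (by
          rw [sub_sub_sub_cancel_right, mul_div_cancel₀ _ two_ne_zero])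
    _ = 2 * (μ.toSphere Set.univ * ∫⁻ s in Set.Ioi 0, f s) := by
        rw [lintegral_add_left (by fun_prop), hint, hint, two_mul]
    _ ≤ 2 ^ Module.finrank ℝ E * μ.toSphere Set.univ * (‖x - x'‖ₑ ^ (n - 1))⁻¹ := by
        have hscale : (ENNReal.ofReal (‖x - x'‖ / 2) ^ (n - 1))⁻¹ =
            2 ^ (n - 1) * (‖x - x'‖ₑ ^ (n - 1))⁻¹ := by
          rw [ENNReal.ofReal_div_of_pos two_pos, ofReal_norm, ENNReal.ofReal_ofNat, ENNReal.inv_pow,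
            ENNReal.inv_div (.inl ENNReal.ofNat_ne_top) (.inl two_ne_zero), ENNReal.div_eq_inv_mul,
            mul_pow, mul_comm, ENNReal.inv_pow]
        have hpow : (2 : ℝ≥0∞) ^ Module.finrank ℝ E = 2 * 2 * 2 ^ (n - 1) := by
          rw [← pow_two, ← pow_add]; congr 1; lia
        grw [lintegral_Ioi_inv_max_pow_le (by lia) _, hscale, hpow]
        exact le_of_eq (by ring)
    _ = 2 ^ Module.finrank ℝ E * μ.toSphere Set.univ *
          rieszKernel (Module.finrank ℝ E - 2) (2 * r) (x - x') := by
        rw [rieszKernel_of_norm_le hnear]; rfl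

theorem toSphere_mul_lintegral_enorm_sq_le (hd : 3 ≤ Module.finrank ℝ E) {ν : Measure E}
    [SigmaFinite ν] {r : ℝ} (hr : 0 < r) {δ : ℝ≥0∞}
    (hδ : ∀ x, ∫⁻ y, rieszKernel (Module.finrank ℝ E - 2) (2 * r) (x - y) ∂ν ≤ δ)
    {u : E → F} (hu : ContDiff ℝ 1 u) :
    μ.toSphere Set.univ * ∫⁻ x, ‖u x‖ₑ ^ 2 ∂ν ≤
      2 ^ Module.finrank ℝ E * δ *
        ∫⁻ y, (‖fderiv ℝ u y‖ₑ + ‖u y‖ₑ / ENNReal.ofReal r) ^ 2 ∂μ := by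
  have : Nontrivial E := Module.nontrivial_of_finrank_pos (R := ℝ) (by lia)
  have hu' : Measurable fun x => ‖u x‖ₑ := hu.continuous.enorm.measurable
  have : Measurable fun x => ‖fderiv ℝ u x‖ₑ :=
    (hu.continuous_fderiv one_ne_zero).enorm.measurable
  set S := μ.toSphere Set.univ
  have hS : S ≠ 0 := Measure.measure_univ_ne_zero.mpr μ.toSphere_ne_zero
  have hS' : S ≠ ∞ := measure_ne_top _ _
  have h := lintegral_sq_le_of_schur (ν := ν) (μ := μ) (b := fun x => S * ‖u x‖ₑ)
    (K := fun x y => rieszKernel (Module.finrank ℝ E - 1) r (x - y))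
    (η := 2 ^ Module.finrank ℝ E * S * δ) (by fun_prop)
    (fun x => by
      grw [lintegral_mono fun x' => lintegral_rieszKernel_mul_rieszKernel_le μ hd r x x',
        lintegral_const_mul _ (by fun_prop), hδ x])
    (g := fun y => ‖fderiv ℝ u y‖ₑ + ‖u y‖ₑ / ENNReal.ofReal r) (by fun_prop) (by fun_prop)
    (fun x => ENNReal.mul_ne_top hS' enorm_ne_top) (toSphere_mul_enorm_le μ hu hr)
  simp only [mul_pow] at h
  rw [lintegral_const_mul _ (by fun_prop)] at h
  refine (ENNReal.mul_le_mul_iff_right hS hS').mp ?_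
  calc S * (S * ∫⁻ x, ‖u x‖ₑ ^ 2 ∂ν) = S ^ 2 * ∫⁻ x, ‖u x‖ₑ ^ 2 ∂ν := by ring
    _ ≤ _ := h
    _ = _ := by ring

variable {V : R3 → ℝ}

theorem lintegral_rieszKernel_withDensity (hV : AEMeasurable V) (r : ℝ) (x : R3) :
    ∫⁻ y, rieszKernel 1 r (x - y) ∂volume.withDensity (fun y => ‖V y‖ₑ) =
      ∫⁻ y in Metric.closedBall x r, ‖V y‖ₑ / ‖x - y‖ₑ := by
  rw [lintegral_withDensity_eq_lintegral_mul₀ hV.enorm (by fun_prop),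
    ← lintegral_indicator Metric.isClosed_closedBall.measurableSet]
  refine lintegral_congr fun y => ?_
  simp only [Pi.mul_apply, rieszKernel, Set.indicator,
    mem_closedBall_iff_norm', zero_sub, norm_neg, mul_ite, mul_zero, pow_one, div_eq_mul_inv]

theorem IsKatoClass.exists_lintegral_le (hV : IsKatoClass V) {ε : ℝ≥0∞} (hε : ε ≠ 0) :
    ∃ r : ℝ, 0 < r ∧ ∀ u : R3 → ℂ, ContDiff ℝ 1 u → ∫⁻ x, ‖V x‖ₑ * ‖u x‖ₑ ^ 2 ≤
      ε * ∫⁻ x, (‖fderiv ℝ u x‖ₑ + ‖u x‖ₑ / ENNReal.ofReal r) ^ 2 := by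
  have hd : Module.finrank ℝ R3 = 3 := finrank_euclideanSpace_fin
  set S := (volume : Measure R3).toSphere Set.univ
  have hS : S ≠ 0 := Measure.measure_univ_ne_zero.mpr (volume : Measure R3).toSphere_ne_zero
  have hS' : S ≠ ∞ := measure_ne_top _ _
  have hδ : 0 < S * ε / 2 ^ 3 := ENNReal.div_pos (mul_ne_zero hS hε) (by simp)
  obtain ⟨ρ, hρδ, hρ⟩ := ((hV.2.eventually_le_const hδ).and self_mem_nhdsWithin).exists
  refine ⟨ρ / 2, half_pos hρ, fun u hu => ?_⟩
  have : SigmaFinite (volume.withDensity fun x : R3 => ‖V x‖ₑ) :=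
    SigmaFinite.withDensity_of_ne_top (ae_of_all _ fun x => enorm_ne_top)
  have h := toSphere_mul_lintegral_enorm_sq_le volume hd.ge (half_pos hρ)
    (ν := volume.withDensity fun x => ‖V x‖ₑ) (δ := S * ε / 2 ^ 3) (fun x => by
      rw [hd, mul_div_cancel₀ _ two_ne_zero, lintegral_rieszKernel_withDensity hV.1]
      exact (le_iSup (fun x => ∫⁻ y in Metric.closedBall x ρ, ‖V y‖ₑ / ‖x - y‖ₑ) x).trans hρδ) hu
  rw [lintegral_withDensity_eq_lintegral_mul₀ hV.1.enorm
    (hu.continuous.enorm.measurable.pow_const 2).aemeasurable, hd,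
    ENNReal.mul_div_cancel (by positivity) (by finiteness), mul_assoc S] at h
  exact (ENNReal.mul_le_mul_iff_right hS hS').mp h

end SmoothBound

section TemperedLift

variable {E F : Type*} [NormedAddCommGroup E] [NormedSpace ℝ E] [FiniteDimensional ℝ E]
  [MeasurableSpace E] [BorelSpace E] [NormedAddCommGroup F] [NormedSpace ℂ F] [CompleteSpace F]
  {μ : Measure E} [μ.HasTemperateGrowth] [IsLocallyFiniteMeasure μ] {p : ℝ≥0∞} [Fact (1 ≤ p)]

theorem toTemperedDistributionCLM_injective :
    Function.Injective (Lp.toTemperedDistributionCLM F μ p) :=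
  LinearMap.ker_eq_bot.mp Lp.ker_toTemperedDistributionCLM_eq_bot

theorem exists_continuousLinearMap_Lp (A : 𝓢'(E, F) →L[ℂ] 𝓢'(E, F))
    (hA : ∀ f : Lp F p μ, ∃ g : Lp F p μ, A f = (g : 𝓢'(E, F))) :
    ∃ T : Lp F p μ →L[ℂ] Lp F p μ, ∀ f : Lp F p μ, A f = (T f : 𝓢'(E, F)) := by
  have hι := toTemperedDistributionCLM_injective (F := F) (μ := μ) (p := p)
  set ι := Lp.toTemperedDistributionCLM F μ p
  choose T hT using hA
  replace hT : ∀ f, A (ι f) = ι (T f) := hT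
  let L : Lp F p μ →ₗ[ℂ] Lp F p μ :=
    { toFun := T
      map_add' := fun f g => hι (by simp only [map_add, ← hT])
      map_smul' := fun c f => hι (by simp only [map_smul, ← hT, RingHom.id_apply]) }
  -- `L` is continuous by the closed graph theorem, because `A` and `ι` are continuous into `𝓢'`.
  have hgraph : (L.graph : Set (Lp F p μ × Lp F p μ)) = {z | A (ι z.1) = ι z.2} := by
    ext z
    simp only [SetLike.mem_coe, LinearMap.mem_graph_iff, Set.mem_ofPred_eq, hT, hι.eq_iff]
    exact eq_comm
  refine ⟨⟨L, L.continuous_of_isClosed_graph ?_⟩, hT⟩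
  rw [hgraph]
  exact isClosed_eq (by fun_prop) (by fun_prop)

end TemperedLift

section PartialDeriv

theorem partialDeriv_eq_of_lineDerivOp_eq (i : Fin 3) (u : H1) (g : L2)
    (h : ∂_{(EuclideanSpace.single i (1 : ℝ) : R3)} ((u : L2) : 𝓢'(R3, ℂ)) = (g : 𝓢'(R3, ℂ))) :
    partialDeriv i u = g :=
  toTemperedDistributionCLM_injective ((partialDeriv_spec i u).symm.trans h)

theorem partialDeriv_add (i : Fin 3) (u v : H1) :
    partialDeriv i (u + v) = partialDeriv i u + partialDeriv i v := by
  apply partialDeriv_eq_of_lineDerivOp_eq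
  rw [← Lp.toTemperedDistributionCLM_apply, ← Lp.toTemperedDistributionCLM_apply, map_add,
    Submodule.coe_add, map_add]
  simp only [Lp.toTemperedDistributionCLM_apply]
  rw [← partialDeriv_spec, ← partialDeriv_spec, LineDeriv.lineDerivOp_add]

theorem partialDeriv_smul (i : Fin 3) (c : ℂ) (u : H1) :
    partialDeriv i (c • u) = c • partialDeriv i u := by
  apply partialDeriv_eq_of_lineDerivOp_eq
  rw [← Lp.toTemperedDistributionCLM_apply, ← Lp.toTemperedDistributionCLM_apply, map_smul,
    Submodule.coe_smul, map_smul]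
  simp only [Lp.toTemperedDistributionCLM_apply]
  rw [← partialDeriv_spec, LineDeriv.lineDerivOp_smul]

theorem partialDeriv_sub (i : Fin 3) (u v : H1) :
    partialDeriv i (u - v) = partialDeriv i u - partialDeriv i v := by
  rw [eq_sub_iff_add_eq, ← partialDeriv_add, sub_add_cancel]

theorem partialDeriv_schwartzToH1 (i : Fin 3) (f : 𝓢(R3, ℂ)) :
    partialDeriv i (schwartzToH1 f) =
      (∂_{(EuclideanSpace.single i (1 : ℝ) : R3)} f).toLp 2 volume := by
  apply partialDeriv_eq_of_lineDerivOp_eq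
  rw [schwartzToH1, Lp.toTemperedDistribution_toLp_eq, Lp.toTemperedDistribution_toLp_eq,
    TemperedDistribution.lineDerivOp_toTemperedDistributionCLM_eq]

theorem gradNormSq_nonneg (u : H1) : 0 ≤ gradNormSq u :=
  Finset.sum_nonneg fun _ _ => by positivity

theorem norm_partialDeriv_sq_le (i : Fin 3) (u : H1) : ‖partialDeriv i u‖ ^ 2 ≤ gradNormSq u :=
  Finset.single_le_sum (f := fun i => ‖partialDeriv i u‖ ^ 2) (fun _ _ => by positivity)
    (Finset.mem_univ i)

end PartialDeriv

section Density

open TemperedDistribution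

theorem dense_H1 : Dense (H1 : Set L2) := by
  refine (SchwartzMap.denseRange_toLpCLM (E := R3) (F := ℂ) (μ := volume) (p := 2)
    ENNReal.ofNat_ne_top).mono ?_
  rintro _ ⟨f, rfl⟩
  exact toLp_mem_H1 f

theorem exists_continuousLinearMap_of_besselPotential_eq :
    ∃ (T : L2 →L[ℂ] L2) (D : Fin 3 → L2 →L[ℂ] L2), ∀ (u : H1) (f : L2),
      besselPotential R3 ℂ 1 (u : L2) = (f : 𝓢'(R3, ℂ)) →
        u = T f ∧ ∀ i, partialDeriv i u = D i f := by
  have hJ (f : L2) : MemSobolev 1 2 (besselPotential R3 ℂ (-1) (f : 𝓢'(R3, ℂ))) := by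
    rw [memSobolev_besselPotential_iff, neg_add_cancel, memSobolev_zero_iff]
    exact ⟨f, rfl⟩
  obtain ⟨T, hT⟩ := exists_continuousLinearMap_Lp (μ := (volume : Measure R3)) (p := 2)
    (besselPotential R3 ℂ (-1)) fun f => memSobolev_zero_iff.mp ((hJ f).mono zero_le_one)
  choose D hD using fun i : Fin 3 =>
    exists_continuousLinearMap_Lp (μ := (volume : Measure R3)) (p := 2)
      (LineDeriv.lineDerivOpCLM ℂ 𝓢'(R3, ℂ) (EuclideanSpace.single i (1 : ℝ) : R3) ∘L
        besselPotential R3 ℂ (-1)) fun f => memSobolev_zero_iff.mp (by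
          simpa using (hJ f).lineDerivOp (m := (EuclideanSpace.single i (1 : ℝ) : R3)))
  refine ⟨T, D, fun u f huf => ?_⟩
  rw [← besselPotential_neg_apply_eq_iff] at huf
  refine ⟨toTemperedDistributionCLM_injective (huf.symm.trans (hT f)), fun i => ?_⟩
  apply partialDeriv_eq_of_lineDerivOp_eq
  rw [← hD, ← huf]
  rfl

theorem exists_besselPotential_schwartzToH1_eq (s : ℝ) (φ : 𝓢(R3, ℂ)) : ∃ ψ : 𝓢(R3, ℂ),
    besselPotential R3 ℂ s (schwartzToH1 ψ : L2) = ((φ.toLp 2 volume : L2) : 𝓢'(R3, ℂ)) := by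
  refine ⟨SchwartzMap.fourierMultiplierCLM ℂ
    (fun x : R3 => (((1 + ‖x‖ ^ 2) ^ (-s / 2) : ℝ) : ℂ)) φ, ?_⟩
  rw [← besselPotential_neg_apply_eq_iff, schwartzToH1, Lp.toTemperedDistribution_toLp_eq,
    Lp.toTemperedDistribution_toLp_eq, besselPotential,
    fourierMultiplierCLM_toTemperedDistributionCLM_eq (by fun_prop)]

theorem exists_tendsto_schwartzToH1 (u : H1) : ∃ φ : ℕ → 𝓢(R3, ℂ),
    Tendsto (fun n => (schwartzToH1 (φ n) : L2)) atTop (𝓝 u) ∧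
      ∀ i, Tendsto (fun n => partialDeriv i (schwartzToH1 (φ n))) atTop (𝓝 (partialDeriv i u)) := by
  obtain ⟨T, D, hTD⟩ := exists_continuousLinearMap_of_besselPotential_eq
  obtain ⟨f, hf⟩ := u.2
  obtain ⟨g, hgmem, hg⟩ := mem_closure_iff_seq_limit.mp
    ((SchwartzMap.denseRange_toLpCLM (E := R3) (F := ℂ) (μ := volume) (p := 2)
      ENNReal.ofNat_ne_top) f)
  choose χ hχ using hgmem
  choose φ hφ using fun n => exists_besselPotential_schwartzToH1_eq 1 (χ n)
  replace hφ n : besselPotential R3 ℂ 1 (schwartzToH1 (φ n) : L2) = (g n : 𝓢'(R3, ℂ)) := by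
    rw [hφ, ← hχ]
    rfl
  refine ⟨φ, ?_, fun i => ?_⟩
  · simp only [(hTD _ _ hf).1, fun n => (hTD _ _ (hφ n)).1]
    exact (T.continuous.tendsto f).comp hg
  · simp only [(hTD _ _ hf).2 i, fun n => (hTD _ _ (hφ n)).2 i]
    exact ((D i).continuous.tendsto f).comp hg

theorem inner_toLp_lineDerivOp_left (φ ψ : 𝓢(R3, ℂ)) (m : R3) :
    inner ℂ ((∂_{m} φ).toLp 2 volume : L2) (ψ.toLp 2 volume : L2) =
      -inner ℂ (φ.toLp 2 volume : L2) ((∂_{m} ψ).toLp 2 volume) := by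
  have h := SchwartzMap.integral_bilinear_lineDerivOp_right_eq_neg_left (μ := volume) φ ψ
    ((ContinuousLinearMap.mul ℝ ℂ).comp (Complex.conjCLE : ℂ →L[ℝ] ℂ)) m
  simp only [SchwartzMap.inner_toL2_toL2_eq, RCLike.inner_apply']
  exact (neg_eq_iff_eq_neg.mpr h).symm

theorem inner_partialDeriv_left (i : Fin 3) (u v : H1) :
    inner ℂ (partialDeriv i u) (v : L2) = -inner ℂ (u : L2) (partialDeriv i v) := by
  obtain ⟨φ, hφ, hφ'⟩ := exists_tendsto_schwartzToH1 u
  obtain ⟨ψ, hψ, hψ'⟩ := exists_tendsto_schwartzToH1 v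
  refine tendsto_nhds_unique ((hφ' i).inner hψ) ((hφ.inner (hψ' i)).neg.congr fun n => ?_)
  rw [partialDeriv_schwartzToH1, partialDeriv_schwartzToH1]
  exact (inner_toLp_lineDerivOp_left _ _ _).symm

end Density

section FormBound

theorem opNorm_sq_le_sum {ι E F : Type*} [Fintype ι] [NormedAddCommGroup E] [InnerProductSpace ℝ E]
    [NormedAddCommGroup F] [NormedSpace ℝ F] (b : OrthonormalBasis ι ℝ E) (A : E →L[ℝ] F) :
    ‖A‖ ^ 2 ≤ ∑ i, ‖A (b i)‖ ^ 2 := by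
  rw [← Real.le_sqrt (norm_nonneg _) (by positivity)]
  refine A.opNorm_le_bound (Real.sqrt_nonneg _) fun x => ?_
  calc ‖A x‖ = ‖∑ i, inner ℝ (b i) x • A (b i)‖ := by
        conv_lhs => rw [← b.sum_repr' x, map_sum]
        simp only [map_smul]
    _ ≤ ∑ i, ‖A (b i)‖ * ‖inner ℝ (b i) x‖ := by
        refine (norm_sum_le _ _).trans_eq ?_
        simp only [norm_smul, mul_comm]
    _ ≤ √(∑ i, ‖A (b i)‖ ^ 2) * √(∑ i, ‖inner ℝ (b i) x‖ ^ 2) := Real.sum_mul_le_sqrt_mul_sqrt _ _ _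
    _ = √(∑ i, ‖A (b i)‖ ^ 2) * ‖x‖ := by
        rw [b.sum_sq_norm_inner_right, Real.sqrt_sq (norm_nonneg x)]

theorem lintegral_enorm_sq (f : L2) : ∫⁻ x, ‖f x‖ₑ ^ 2 = ENNReal.ofReal (‖f‖ ^ 2) := by
  rw [ENNReal.ofReal_pow (norm_nonneg _), ofReal_norm, Lp.enorm_def,
    eLpNorm_eq_lintegral_rpow_enorm_toReal two_ne_zero ENNReal.ofNat_ne_top, ← ENNReal.rpow_two,
    ← ENNReal.rpow_mul]
  simp

theorem lintegral_enorm_schwartz_sq (φ : 𝓢(R3, ℂ)) :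
    ∫⁻ x, ‖φ x‖ₑ ^ 2 = ENNReal.ofReal (‖φ.toLp 2 volume‖ ^ 2) := by
  rw [← lintegral_enorm_sq]
  refine lintegral_congr_ae ?_
  filter_upwards [φ.coeFn_toLp 2 volume] with x hx
  rw [hx]

theorem lintegral_enorm_fderiv_sq_le (φ : 𝓢(R3, ℂ)) :
    ∫⁻ x, ‖fderiv ℝ φ x‖ₑ ^ 2 ≤ ENNReal.ofReal (gradNormSq (schwartzToH1 φ)) := by
  have hpt (x : R3) : ‖fderiv ℝ φ x‖ₑ ^ 2 ≤
      ∑ i, ‖(∂_{(EuclideanSpace.single i (1 : ℝ) : R3)} φ) x‖ₑ ^ 2 := by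
    simp only [SchwartzMap.lineDerivOp_apply_eq_fderiv, ← ofReal_norm,
      ← ENNReal.ofReal_pow (norm_nonneg _), ← ENNReal.ofReal_sum_of_nonneg fun _ _ => sq_nonneg _]
    gcongr
    simpa using opNorm_sq_le_sum (EuclideanSpace.basisFun (Fin 3) ℝ) (fderiv ℝ φ x)
  refine (lintegral_mono hpt).trans_eq ?_
  rw [lintegral_finsetSum _ (fun i _ => by fun_prop), gradNormSq,
    ENNReal.ofReal_sum_of_nonneg fun _ _ => sq_nonneg _]
  simp only [partialDeriv_schwartzToH1, lintegral_enorm_schwartz_sq]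

theorem lintegral_enorm_fderiv_add_sq_le (φ : 𝓢(R3, ℂ)) {r : ℝ} (hr : 0 < r) :
    ∫⁻ x, (‖fderiv ℝ φ x‖ₑ + ‖φ x‖ₑ / ENNReal.ofReal r) ^ 2 ≤
      ENNReal.ofReal (2 * (gradNormSq (schwartzToH1 φ) +
        ‖(schwartzToH1 φ : L2)‖ ^ 2 / r ^ 2)) := by
  have hpt (x : R3) : (‖fderiv ℝ φ x‖ₑ + ‖φ x‖ₑ / ENNReal.ofReal r) ^ 2 ≤
      2 * (‖fderiv ℝ φ x‖ₑ ^ 2 + ‖φ x‖ₑ ^ 2 / ENNReal.ofReal r ^ 2) := by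
    have := two_mul_mul_le_sq_add_sq ‖fderiv ℝ φ x‖ₑ (‖φ x‖ₑ / ENNReal.ofReal r)
    rw [add_sq', two_mul (_ + _)]
    simp only [div_eq_mul_inv, mul_pow, ENNReal.inv_pow] at this ⊢
    gcongr
  have hm : Measurable fun x => ‖φ x‖ₑ ^ 2 := by fun_prop
  refine (lintegral_mono hpt).trans ?_
  rw [lintegral_const_mul' _ _ (by finiteness), lintegral_add_right _ (by fun_prop),
    ENNReal.ofReal_mul zero_le_two, ENNReal.ofReal_add (gradNormSq_nonneg _) (by positivity),
    ENNReal.ofReal_div_of_pos (by positivity), ENNReal.ofReal_pow hr.le]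
  simp only [div_eq_mul_inv]
  rw [lintegral_mul_const _ hm, lintegral_enorm_schwartz_sq, ENNReal.ofReal_ofNat]
  gcongr
  · exact lintegral_enorm_fderiv_sq_le φ
  · exact le_rfl

theorem lintegral_mul_enorm_sq_le_of_tendsto {X F : Type*} [MeasurableSpace X] {μ : Measure X}
    [NormedAddCommGroup F] {p : ℝ≥0∞} [Fact (1 ≤ p)] {w : X → ℝ≥0∞} (hw : AEMeasurable w μ)
    (hw' : ∀ x, w x ≠ ∞) {s : ℕ → Lp F p μ} {u : Lp F p μ} (hs : Tendsto s atTop (𝓝 u))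
    {c : ℕ → ℝ≥0∞} {c' : ℝ≥0∞} (hc : Tendsto c atTop (𝓝 c'))
    (h : ∀ n, ∫⁻ x, w x * ‖s n x‖ₑ ^ 2 ∂μ ≤ c n) : ∫⁻ x, w x * ‖u x‖ₑ ^ 2 ∂μ ≤ c' := by
  obtain ⟨ns, hns, hae⟩ := (tendstoInMeasure_of_tendsto_Lp hs).exists_seq_tendsto_ae
  calc ∫⁻ x, w x * ‖u x‖ₑ ^ 2 ∂μ
      = ∫⁻ x, liminf (fun n => w x * ‖s (ns n) x‖ₑ ^ 2) atTop ∂μ := by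
        refine lintegral_congr_ae ?_
        filter_upwards [hae] with x hx
        exact (ENNReal.Tendsto.const_mul ((ENNReal.continuous_pow 2).tendsto _ |>.comp hx.enorm)
          (.inr (hw' x))).liminf_eq.symm
    _ ≤ liminf (fun n => ∫⁻ x, w x * ‖s (ns n) x‖ₑ ^ 2 ∂μ) atTop :=
        lintegral_liminf_le' fun n => hw.mul ((Lp.aestronglyMeasurable _).enorm.pow_const 2)
    _ ≤ liminf (c ∘ ns) atTop := liminf_le_liminf (.of_forall fun n => h (ns n))
    _ = c' := (hc.comp hns.tendsto_atTop).liminf_eq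

variable {V : R3 → ℝ}

theorem IsKatoClass.exists_lintegral_schwartzToH1_le (hV : IsKatoClass V) {ε : ℝ}
    (hε : 0 < ε) : ∃ C, 0 ≤ C ∧ ∀ φ : 𝓢(R3, ℂ),
      ∫⁻ x, ‖V x‖ₑ * ‖(schwartzToH1 φ : L2) x‖ₑ ^ 2 ≤
        ENNReal.ofReal (ε * gradNormSq (schwartzToH1 φ) + C * ‖(schwartzToH1 φ : L2)‖ ^ 2) := by
  obtain ⟨r, hr, h⟩ := hV.exists_lintegral_le (ε := ENNReal.ofReal (ε / 2)) (by simpa using hε)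
  refine ⟨ε / r ^ 2, by positivity, fun φ => ?_⟩
  calc ∫⁻ x, ‖V x‖ₑ * ‖(schwartzToH1 φ : L2) x‖ₑ ^ 2 = ∫⁻ x, ‖V x‖ₑ * ‖φ x‖ₑ ^ 2 := by
        refine lintegral_congr_ae ?_
        filter_upwards [φ.coeFn_toLp 2 volume] with x hx
        rw [schwartzToH1, hx]
    _ ≤ _ := (h φ (φ.smooth 1)).trans (mul_le_mul_right (lintegral_enorm_fderiv_add_sq_le φ hr) _)
    _ = _ := by
        rw [← ENNReal.ofReal_mul (by positivity)]
        congr 1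
        ring

theorem IsKatoClass.exists_form_bound (hV : IsKatoClass V) {ε : ℝ} (hε : 0 < ε) :
    ∃ C, 0 ≤ C ∧ ∀ u : H1, ∫⁻ x, ‖V x‖ₑ * ‖(u : L2) x‖ₑ ^ 2 ≤
      ENNReal.ofReal (ε * gradNormSq u + C * ‖(u : L2)‖ ^ 2) := by
  obtain ⟨C, hC0, hC⟩ := hV.exists_lintegral_schwartzToH1_le hε
  refine ⟨C, hC0, fun u => ?_⟩
  obtain ⟨φ, hφ, hφ'⟩ := exists_tendsto_schwartzToH1 u
  have hgrad : Tendsto (fun n => gradNormSq (schwartzToH1 (φ n))) atTop (𝓝 (gradNormSq u)) :=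
    tendsto_finsetSum _ fun i _ => (hφ' i).norm.pow 2
  exact lintegral_mul_enorm_sq_le_of_tendsto hV.1.enorm (fun _ => enorm_ne_top) hφ
    (ENNReal.tendsto_ofReal ((hgrad.const_mul ε).add ((hφ.norm.pow 2).const_mul C)))
    fun n => hC (φ n)

end FormBound

section Form

variable {V : R3 → ℝ}

theorem inner_eq_integral (f g : L2) : inner ℂ f g = ∫ x, g x * conj (f x) := by
  rw [L2.inner_def]
  rfl

theorem IsKatoClass.lintegral_potential_lt_top (hV : IsKatoClass V) (u : H1) :
    ∫⁻ x, ‖V x‖ₑ * ‖(u : L2) x‖ₑ ^ 2 < ∞ := by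
  obtain ⟨C, -, hC⟩ := hV.exists_form_bound one_pos
  exact (hC u).trans_lt ENNReal.ofReal_lt_top

theorem IsKatoClass.integrable_potential (hV : IsKatoClass V) (u v : H1) :
    Integrable (fun x => (V x : ℂ) * ((u : L2) x * conj ((v : L2) x))) := by
  have hVm : AEStronglyMeasurable (fun x => (V x : ℂ)) volume :=
    Complex.continuous_ofReal.comp_aestronglyMeasurable hV.1.aestronglyMeasurable
  refine ⟨hVm.mul ((Lp.aestronglyMeasurable _).mul
    (Complex.continuous_conj.comp_aestronglyMeasurable (Lp.aestronglyMeasurable _))), ?_⟩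
  have hm : AEMeasurable (fun x => ‖V x‖ₑ * ‖(u : L2) x‖ₑ ^ 2) volume :=
    hV.1.enorm.mul ((Lp.aestronglyMeasurable _).enorm.pow_const 2)
  calc ∫⁻ x, ‖(V x : ℂ) * ((u : L2) x * conj ((v : L2) x))‖ₑ
      ≤ ∫⁻ x, (‖V x‖ₑ * ‖(u : L2) x‖ₑ ^ 2 + ‖V x‖ₑ * ‖(v : L2) x‖ₑ ^ 2) := by
        refine lintegral_mono fun x => ?_
        have hc : ‖conj ((v : L2) x)‖ₑ = ‖(v : L2) x‖ₑ := by simp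
        have hr : ‖(V x : ℂ)‖ₑ = ‖V x‖ₑ := by simp [← ofReal_norm]
        rw [enorm_mul, enorm_mul, hc, hr, ← mul_add]
        gcongr
        refine le_trans ?_ (two_mul_mul_le_sq_add_sq _ _)
        rw [mul_assoc, two_mul]
        exact le_self_add
    _ < ∞ := by
        rw [lintegral_add_left' hm]
        exact ENNReal.add_lt_top.mpr
          ⟨hV.lintegral_potential_lt_top u, hV.lintegral_potential_lt_top v⟩

theorem q_eq_inner (u v : H1) : q V u v =
    (∑ i : Fin 3, inner ℂ (partialDeriv i v) (partialDeriv i u)) +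
      ∫ x, (V x : ℂ) * ((u : L2) x * conj ((v : L2) x)) := by
  simp only [q, inner_eq_integral]

theorem q_self (u : H1) :
    q V u u = ((gradNormSq u + ∫ x, V x * ‖(u : L2) x‖ ^ 2 : ℝ) : ℂ) := by
  rw [q_eq_inner, gradNormSq, Complex.ofReal_add, ← integral_complex_ofReal]
  simp only [inner_self_eq_norm_sq_to_K, Complex.mul_conj, Complex.normSq_eq_norm_sq]
  push_cast
  rfl

theorem IsKatoClass.exists_abs_potential_le (hV : IsKatoClass V) {ε : ℝ} (hε : 0 < ε) :
    ∃ C : ℝ, 0 ≤ C ∧ ∀ u : H1, |∫ x, V x * ‖(u : L2) x‖ ^ 2| ≤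
      ε * gradNormSq u + C * ‖(u : L2)‖ ^ 2 := by
  obtain ⟨C, hC0, hC⟩ := hV.exists_form_bound hε
  refine ⟨C, hC0, fun u => ?_⟩
  have h0 : 0 ≤ ε * gradNormSq u + C * ‖(u : L2)‖ ^ 2 := by
    have := gradNormSq_nonneg u
    positivity
  rw [← Real.norm_eq_abs, ← ENNReal.ofReal_le_ofReal_iff h0, ofReal_norm]
  refine (enorm_integral_le_lintegral_enorm _).trans (le_trans (le_of_eq ?_) (hC u))
  simp [enorm_mul, enorm_pow]

theorem IsKatoClass.exists_q_bounds (hV : IsKatoClass V) :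
    ∃ a₀ : ℝ, 1 < a₀ ∧ ∀ a : ℝ, a₀ ≤ a → ∀ u : H1,
      (q V u u).im = 0 ∧
      (1 / 2) * gradNormSq u - a * ‖(u : L2)‖ ^ 2 ≤ (q V u u).re ∧
      (q V u u).re ≤ (3 / 2) * gradNormSq u + a * ‖(u : L2)‖ ^ 2 := by
  obtain ⟨C, hC0, hC⟩ := hV.exists_abs_potential_le (ε := 1 / 2) (by norm_num)
  refine ⟨C + 2, by linarith, fun a ha u => ?_⟩
  rw [q_self, Complex.ofReal_re, Complex.ofReal_im]
  have h1 := abs_le.mp (hC u)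
  have h2 : C * ‖(u : L2)‖ ^ 2 ≤ a * ‖(u : L2)‖ ^ 2 := by gcongr; linarith
  exact ⟨rfl, by linarith [h1.1], by linarith [h1.2]⟩

theorem IsKatoClass.q_add_left (hV : IsKatoClass V) (u v w : H1) :
    q V (u + v) w = q V u w + q V v w := by
  have e : ∫ x, (V x : ℂ) * (((u + v : H1) : L2) x * conj ((w : L2) x)) =
      (∫ x, (V x : ℂ) * ((u : L2) x * conj ((w : L2) x))) +
        ∫ x, (V x : ℂ) * ((v : L2) x * conj ((w : L2) x)) := by
    rw [← integral_add (hV.integrable_potential u w) (hV.integrable_potential v w)]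
    apply integral_congr_ae
    filter_upwards [Lp.coeFn_add (u : L2) (v : L2)] with x hx
    rw [Submodule.coe_add, hx, Pi.add_apply]
    ring
  simp only [q_eq_inner, partialDeriv_add, inner_add_right, Finset.sum_add_distrib, e]
  ring

theorem q_smul_left (c : ℂ) (u v : H1) : q V (c • u) v = c * q V u v := by
  have e : ∫ x, (V x : ℂ) * (((c • u : H1) : L2) x * conj ((v : L2) x)) =
      c * ∫ x, (V x : ℂ) * ((u : L2) x * conj ((v : L2) x)) := by
    rw [← integral_const_mul]
    apply integral_congr_ae
    filter_upwards [Lp.coeFn_smul c (u : L2)] with x hx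
    rw [Submodule.coe_smul, hx, Pi.smul_apply, smul_eq_mul]
    ring
  simp only [q_eq_inner, partialDeriv_smul, inner_smul_right, ← Finset.mul_sum, e]
  ring

theorem q_conj_symm (u v : H1) : conj (q V u v) = q V v u := by
  rw [q_eq_inner, q_eq_inner, map_add, map_sum, ← integral_conj]
  simp only [inner_conj_symm, map_mul, Complex.conj_ofReal, Complex.conj_conj]
  congr 2
  ext x
  ring

theorem IsKatoClass.isLowerSemiboundedForm (hV : IsKatoClass V) :
    IsLowerSemiboundedForm H1 (q V) where
  dense := dense_H1
  add_left := hV.q_add_left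
  smul_left := q_smul_left
  conj_symm := q_conj_symm
  lower_bound := by
    obtain ⟨a, -, ha⟩ := hV.exists_q_bounds
    refine ⟨a, fun u => ?_⟩
    have h := (ha a le_rfl u).2.1
    have := gradNormSq_nonneg u
    linarith

theorem inner_toLp_laplacian (u : H1) (f : 𝓢(R3, ℂ)) :
    inner ℂ ((Δ f).toLp 2 volume : L2) (u : L2) =
      -∑ i : Fin 3, inner ℂ (partialDeriv i (schwartzToH1 f)) (partialDeriv i u) := by
  have e : ((Δ f).toLp 2 volume : L2) = ∑ i : Fin 3, partialDeriv i
      (schwartzToH1 (∂_{(EuclideanSpace.single i (1 : ℝ) : R3)} f)) := by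
    simp only [partialDeriv_schwartzToH1]
    rw [SchwartzMap.laplacian_eq_sum (EuclideanSpace.basisFun (Fin 3) ℝ)]
    simp only [← SchwartzMap.toLpCLM_apply (𝕜 := ℂ), map_sum, EuclideanSpace.basisFun_apply]
  rw [e, sum_inner, ← Finset.sum_neg_distrib]
  refine Finset.sum_congr rfl fun i _ => ?_
  rw [inner_partialDeriv_left, partialDeriv_schwartzToH1]
  rfl

theorem IsKatoClass.integrable_mul_schrodinger_and_q_eq (hV : IsKatoClass V) (u : H1)
    (f : 𝓢(R3, ℂ)) :
    Integrable (fun x => (u : L2) x * conj (schrodinger V f x)) ∧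
      q V u (schwartzToH1 f) = ∫ x, (u : L2) x * conj (schrodinger V f x) := by
  have hpot := hV.integrable_potential u (schwartzToH1 f)
  have hlap : Integrable fun x => (u : L2) x * conj (((Δ f).toLp 2 volume : L2) x) := by
    simpa only [RCLike.inner_apply] using
      L2.integrable_inner (𝕜 := ℂ) ((Δ f).toLp 2 volume : L2) (u : L2)
  have hae : (fun x => -((u : L2) x * conj (((Δ f).toLp 2 volume : L2) x)) +
      (V x : ℂ) * ((u : L2) x * conj ((schwartzToH1 f : L2) x))) =ᵐ[volume]
      fun x => (u : L2) x * conj (schrodinger V f x) := by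
    filter_upwards [f.coeFn_toLp 2 volume, (Δ f).coeFn_toLp 2 volume] with x h1 h2
    rw [h2, schwartzToH1, h1, schrodinger, map_add, map_neg, map_mul, Complex.conj_ofReal]
    ring
  refine ⟨(hlap.fun_neg.add hpot).congr hae, ?_⟩
  rw [← integral_congr_ae hae, integral_add hlap.fun_neg hpot, integral_neg, ← inner_eq_integral,
    inner_toLp_laplacian, neg_neg, q_eq_inner]

end Form

section Bessel

open TemperedDistribution

variable {E F : Type*} [NormedAddCommGroup E] [InnerProductSpace ℝ E] [FiniteDimensional ℝ E]
  [MeasurableSpace E] [BorelSpace E] [NormedAddCommGroup F]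

theorem besselPotential_two_eq [NormedSpace ℂ F] (T : 𝓢'(E, F)) :
    besselPotential E F 2 T = T - (((2 * Real.pi) ^ 2)⁻¹ : ℂ) • Δ T := by
  have hsymb : (fun x : E => (((1 + ‖x‖ ^ 2) ^ ((2 : ℝ) / 2) : ℝ) : ℂ)) =
      (fun _ => (1 : ℂ)) + fun x => ((‖x‖ ^ 2 : ℝ) : ℂ) := by
    ext x; simp
  have hΔ : fourierMultiplierCLM F (fun x : E => ((‖x‖ ^ 2 : ℝ) : ℂ)) T =
      -((((2 * Real.pi) ^ 2)⁻¹ : ℂ) • Δ T) := by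
    rw [laplacian_eq_fourierMultiplierCLM, ← Complex.coe_smul, smul_smul, ← neg_smul]
    push_cast
    rw [mul_neg, neg_neg, inv_mul_cancel₀ (by simp [Real.pi_ne_zero]), one_smul]
  have hadd : fourierMultiplierCLM F ((fun _ => (1 : ℂ)) + fun x : E => ((‖x‖ ^ 2 : ℝ) : ℂ)) T =
      T + fourierMultiplierCLM F (fun x : E => ((‖x‖ ^ 2 : ℝ) : ℂ)) T := by
    simp only [fourierMultiplierCLM_apply, smulLeftCLM_add (F := F) (g₁ := fun _ : E => (1 : ℂ))
      (g₂ := fun x : E => ((‖x‖ ^ 2 : ℝ) : ℂ)) (by fun_prop) (by fun_prop), add_apply,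
      FourierTransform.fourierInv_add, smulLeftCLM_const, one_smul,
      FourierTransform.fourierInv_fourier_eq]
  rw [besselPotential, hsymb, hadd, hΔ, sub_eq_add_neg]

theorem memSobolev_add_one_of_lineDerivOp [InnerProductSpace ℂ F] [CompleteSpace F] {ι : Type*}
    [Fintype ι] (b : OrthonormalBasis ι ℝ E) {s : ℝ} {T : 𝓢'(E, F)} (hT : MemSobolev s 2 T)
    (h : ∀ i, MemSobolev s 2 (∂_{b i} T)) : MemSobolev (s + 1) 2 T := by
  rw [show s + 1 = 2 + (s - 1) by ring, ← memSobolev_besselPotential_iff, besselPotential_two_eq,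
    laplacian_eq_sum b]
  refine (hT.mono (sub_one_lt s).le).sub (.smul _ ?_)
  exact Finset.sum_induction _ (MemSobolev (s - 1) 2) (fun _ _ => .add)
    (memSobolev_fun_zero E F _ _) fun i _ => (h i).lineDerivOp

end Bessel

section Closed

open TemperedDistribution

theorem mem_H1_of_lineDerivOp_eq {u : L2} {g : Fin 3 → L2}
    (h : ∀ i, ∂_{(EuclideanSpace.single i (1 : ℝ) : R3)} (u : 𝓢'(R3, ℂ)) = (g i : 𝓢'(R3, ℂ))) :
    u ∈ H1 := by
  rw [mem_H1_iff, ← zero_add (1 : ℝ)]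
  refine memSobolev_add_one_of_lineDerivOp (EuclideanSpace.basisFun (Fin 3) ℝ)
    (memSobolev_zero_iff.mpr ⟨u, rfl⟩) fun i => memSobolev_zero_iff.mpr ⟨g i, ?_⟩
  rw [EuclideanSpace.basisFun_apply, h]

theorem lineDerivOp_eq_of_tendsto {s : ℕ → H1} {u g : L2} (i : Fin 3)
    (hu : Tendsto (fun n => (s n : L2)) atTop (𝓝 u))
    (hg : Tendsto (fun n => partialDeriv i (s n)) atTop (𝓝 g)) :
    ∂_{(EuclideanSpace.single i (1 : ℝ) : R3)} (u : 𝓢'(R3, ℂ)) = (g : 𝓢'(R3, ℂ)) := by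
  have hι := (Lp.toTemperedDistributionCLM ℂ (volume : Measure R3) 2).continuous
  have hD := (LineDeriv.lineDerivOpCLM ℂ 𝓢'(R3, ℂ)
    (EuclideanSpace.single i (1 : ℝ) : R3)).continuous
  refine tendsto_nhds_unique (((hD.comp hι).tendsto u).comp hu)
    (((hι.tendsto g).comp hg).congr fun n => ?_)
  exact (partialDeriv_spec i (s n)).symm

theorem cauchySeq_partialDeriv (i : Fin 3) {s : ℕ → H1}
    (hs : Tendsto (fun p : ℕ × ℕ => gradNormSq (s p.1 - s p.2)) atTop (𝓝 0)) :
    CauchySeq fun n => partialDeriv i (s n) := by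
  rw [cauchySeq_iff_tendsto_dist_atTop_0]
  have h := (Real.continuous_sqrt.tendsto 0).comp hs
  rw [Real.sqrt_zero] at h
  refine squeeze_zero (fun p => dist_nonneg) (fun p => ?_) h
  rw [dist_eq_norm, ← partialDeriv_sub]
  exact Real.le_sqrt_of_sq_le (norm_partialDeriv_sq_le i _)

theorem exists_mem_H1_tendsto_gradNormSq_sub {s : ℕ → H1} {u : L2}
    (hs : Tendsto (fun n => (s n : L2)) atTop (𝓝 u))
    (hs' : Tendsto (fun p : ℕ × ℕ => gradNormSq (s p.1 - s p.2)) atTop (𝓝 0)) :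
    ∃ hu : u ∈ H1, Tendsto (fun n => gradNormSq (s n - ⟨u, hu⟩)) atTop (𝓝 0) := by
  choose g hg using fun i => cauchySeq_tendsto_of_complete (cauchySeq_partialDeriv i hs')
  have hD i := lineDerivOp_eq_of_tendsto i hs (hg i)
  have hu : u ∈ H1 := mem_H1_of_lineDerivOp_eq hD
  have hgrad : Tendsto (fun n => ∑ i, ‖partialDeriv i (s n) - g i‖ ^ 2) atTop
      (𝓝 (∑ _i : Fin 3, 0 ^ 2)) :=
    tendsto_finsetSum _ fun i _ => (tendsto_iff_norm_sub_tendsto_zero.mp (hg i)).pow 2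
  refine ⟨hu, ?_⟩
  simpa [gradNormSq, partialDeriv_sub, partialDeriv_eq_of_lineDerivOp_eq _ ⟨u, hu⟩ _ (hD _)]
    using hgrad

variable {V : R3 → ℝ}

theorem IsKatoClass.exists_gradNormSq_le_and_norm_q_le (hV : IsKatoClass V) :
    ∃ a : ℝ, ∀ u : H1,
      gradNormSq u ≤ 2 * ‖q V u u‖ + 2 * a * ‖(u : L2)‖ ^ 2 ∧
        ‖q V u u‖ ≤ 3 / 2 * gradNormSq u + a * ‖(u : L2)‖ ^ 2 := by
  obtain ⟨a, -, ha⟩ := hV.exists_q_bounds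
  refine ⟨a, fun u => ?_⟩
  obtain ⟨him, hlo, hup⟩ := ha a le_rfl u
  have hgrad := gradNormSq_nonneg u
  rw [← Complex.abs_re_eq_norm.mpr him]
  exact ⟨by linarith [le_abs_self (q V u u).re], abs_le.mpr ⟨by linarith, hup⟩⟩

theorem IsKatoClass.isClosedForm (hV : IsKatoClass V) : IsClosedForm H1 (q V) := by
  intro s u hs hQ
  obtain ⟨a, ha⟩ := hV.exists_gradNormSq_le_and_norm_q_le
  have hcauchy : Tendsto (fun p : ℕ × ℕ => ‖((s p.1 - s p.2 : H1) : L2)‖ ^ 2) atTop (𝓝 0) := by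
    simpa [dist_eq_norm] using (cauchySeq_iff_tendsto_dist_atTop_0.mp hs.cauchySeq).pow 2
  have hgrad : Tendsto (fun p : ℕ × ℕ => gradNormSq (s p.1 - s p.2)) atTop (𝓝 0) := by
    refine squeeze_zero (fun _ => gradNormSq_nonneg _) (fun p => (ha (s p.1 - s p.2)).1) ?_
    have h := (hQ.norm.const_mul 2).add (hcauchy.const_mul (2 * a))
    rwa [norm_zero, mul_zero, mul_zero, add_zero] at h
  obtain ⟨hu, hgrad'⟩ := exists_mem_H1_tendsto_gradNormSq_sub hs hgrad
  have hnorm : Tendsto (fun n => ‖((s n - ⟨u, hu⟩ : H1) : L2)‖ ^ 2) atTop (𝓝 0) := by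
    simpa using (tendsto_iff_norm_sub_tendsto_zero.mp hs).pow 2
  have hbound := (hgrad'.const_mul (3 / 2)).add (hnorm.const_mul a)
  rw [mul_zero, mul_zero, add_zero] at hbound
  exact ⟨hu, squeeze_zero_norm (fun n => (ha _).2) hbound⟩

end Closed

end KatoForm

end

/-- For `V` in the Kato class: the form `q` is well defined on `H¹`, it is the form
`∫ u conj((-Δ + V) v)` of the Schrödinger operator, it satisfies the two-sided bound for all large
`a`, and it is lower semibounded and closed with form domain `H¹`. -/
theorem lemma2p1 (V : KatoForm.R3 → ℝ) (hV : KatoForm.IsKatoClass V) :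
    (∀ u v : KatoForm.H1,
      Integrable (fun x => (V x : ℂ) * ((u : KatoForm.L2) x * conj ((v : KatoForm.L2) x)))) ∧
    (∀ (u : KatoForm.H1) (f : 𝓢(KatoForm.R3, ℂ)),
      Integrable (fun x => (u : KatoForm.L2) x * conj (KatoForm.schrodinger V f x)) ∧
      KatoForm.q V u (KatoForm.schwartzToH1 f) =
        ∫ x, (u : KatoForm.L2) x * conj (KatoForm.schrodinger V f x)) ∧
    (∃ a₀ : ℝ, 1 < a₀ ∧ ∀ a : ℝ, a₀ ≤ a → ∀ u : KatoForm.H1,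
      (KatoForm.q V u u).im = 0 ∧
      (1 / 2) * KatoForm.gradNormSq u - a * ‖(u : KatoForm.L2)‖ ^ 2 ≤ (KatoForm.q V u u).re ∧
      (KatoForm.q V u u).re ≤
        (3 / 2) * KatoForm.gradNormSq u + a * ‖(u : KatoForm.L2)‖ ^ 2) ∧
    KatoForm.IsLowerSemiboundedForm KatoForm.H1 (KatoForm.q V) ∧
    KatoForm.IsClosedForm KatoForm.H1 (KatoForm.q V) :=
  ⟨hV.integrable_potential, hV.integrable_mul_schrodinger_and_q_eq, hV.exists_q_bounds,
    hV.isLowerSemiboundedForm, hV.isClosedForm⟩
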